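/- Proposition 3.5 (having precisely 2 ends is a pro-$\mathcal{C}$ property): Let $\mathcal{C}$ be a variety of finite groups, i.e. an isomorphism-closed class of finite groups closed under taking subgroups, quotients and extensions. Let $G$ and $H$ be finitely generated residually $\mathcal{C}$ groups that are pro-$\mathcal{C}$ equivalent, i.e. their pro-$\mathcal{C}$ completions (the inverse limits of their quotients belonging to $\mathcal{C}$) are isomorphic as topological groups. If $H$ has exactly two ends, then $G$ also has exactly two ends. Here the number of ends of a finitely generated group is the number of ends of its Cayley graph with respect to any finite generating set. -/

import Mathlib

universe u

/-- A class of groups, as a predicate on groups. -/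
abbrev GroupClass : Type (u + 1) := (Q : Type u) → [Group Q] → Prop

/-- A variety of finite groups: a class of finite groups, invariant under isomorphism, that is
closed under taking subgroups, quotients and extensions. -/
structure IsVarietyOfFiniteGroups (C : GroupClass.{u}) : Prop where
  finite : ∀ (Q : Type u) [Group Q], C Q → Finite Q
  of_mulEquiv : ∀ (Q R : Type u) [Group Q] [Group R], Q ≃* R → C Q → C R
  subgroup : ∀ (Q : Type u) [Group Q] (K : Subgroup Q), C Q → C K
  quotient : ∀ (Q : Type u) [Group Q] (N : Subgroup Q) [N.Normal], C Q → C (Q ⧸ N)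
  extension : ∀ (Q : Type u) [Group Q] (N : Subgroup Q) [N.Normal], C N → C (Q ⧸ N) → C Q

/-- The normal subgroups of `G` whose quotient belongs to the class `C`. -/
structure CoNormalSubgroup (C : GroupClass.{u}) (G : Type u) [Group G] where
  toSubgroup : Subgroup G
  normal : toSubgroup.Normal
  quotient_mem : C (G ⧸ toSubgroup)

attribute [instance] CoNormalSubgroup.normal

namespace CoNormalSubgroup

variable {C : GroupClass.{u}} {G : Type u} [Group G]

/-- The quotient `G ⧸ N`, as a discrete topological group. -/
abbrev Quot (N : CoNormalSubgroup C G) : Type u := G ⧸ N.toSubgroup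

instance instTopologicalSpaceQuot (N : CoNormalSubgroup C G) : TopologicalSpace N.Quot := ⊥

instance instDiscreteTopologyQuot (N : CoNormalSubgroup C G) : DiscreteTopology N.Quot := ⟨rfl⟩

/-- The transition map `G ⧸ M → G ⧸ N` for `M ≤ N`. -/
def transition (M N : CoNormalSubgroup C G) (h : M.toSubgroup ≤ N.toSubgroup) :
    M.Quot →* N.Quot :=
  QuotientGroup.map M.toSubgroup N.toSubgroup (MonoidHom.id G) h

end CoNormalSubgroup

/-- The pro-`C` completion of `G`: the inverse limit of the quotients of `G` that belong to `C`,
realized as the group of compatible families in their product. It carries the subspace topology of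
the product topology, where each quotient is discrete. -/
def proCompletion (C : GroupClass.{u}) (G : Type u) [Group G] :
    Subgroup ((N : CoNormalSubgroup C G) → N.Quot) where
  carrier := {x | ∀ (M N : CoNormalSubgroup C G) (h : M.toSubgroup ≤ N.toSubgroup),
    CoNormalSubgroup.transition M N h (x M) = x N}
  one_mem' := fun M N h => map_one (CoNormalSubgroup.transition M N h)
  mul_mem' := fun {x y} hx hy M N h => by
    rw [Pi.mul_apply, Pi.mul_apply, map_mul, hx M N h, hy M N h]
  inv_mem' := fun {x} hx M N h => by
    rw [Pi.inv_apply, Pi.inv_apply, map_inv, hx M N h]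

/-- `G` is residually `C`: every nontrivial element survives in some quotient belonging to `C`. -/
def IsResiduallyClass (C : GroupClass.{u}) (G : Type u) [Group G] : Prop :=
  ∀ g : G, g ≠ 1 → ∃ N : CoNormalSubgroup C G, g ∉ N.toSubgroup

/-- Two groups are pro-`C` equivalent if their pro-`C` completions are isomorphic as topological
groups. -/
def ProEquivalent (C : GroupClass.{u}) (G H : Type u) [Group G] [Group H] : Prop :=
  Nonempty (proCompletion C G ≃ₜ* proCompletion C H)

/-- The number of ends of the Cayley graph of `G` with respect to `S`. For a finite generating set
`S` this is the number of ends of the group `G`, and does not depend on `S`. -/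
noncomputable def numEnds {G : Type u} [Group G] (S : Set G) : ℕ∞ :=
  ENat.card (SimpleGraph.mulCayley S).end

/-! Having two ends amounts to being virtually infinite cyclic, and for residually `C` groups this
can be read off the quotients in `C`.

For `H`: some finite connected `K` containing 1 cuts the Cayley graph into an infinite `E` and an
infinite complement. With only two ends, each translate `g • E` is almost `E` or almost `Eᶜ`
(`finite_symmDiff_or`), so the almost stabilizer of `E` has finite index. On it, the signed count of
`E` against `g • E` is a homomorphism to ℤ. If `g • K` misses `K`, then `E` and `g • E` are strictly
nested (`ssubset_or_ssubset`), so the kernel is finite and some `⟨a⟩` has finite index in `H`.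

Transfer to `G`: its quotients in `C` are compatibly quotients of `H`, and in them the image of
`⟨a⟩` has bounded index. Where this index is largest, the kernel `M` has cyclic image in every
deeper quotient (`exists_forall_isCyclic_map`), so `M` is abelian by residuality. Closure under
extensions puts `G/M^p` in `C` for a suitable prime `p`, so `M = ⟨m⟩M^p`. Then `M/⟨m⟩` is finitely
generated and `p`-divisible, hence finite. Finally `G` is infinite because its completion contains a
copy of `H`, and `card_end_mulCayley_eq_two` applies. -/

namespace SimpleGraph

/-! ### Ends of a graph and vertex sets with finite boundary -/

variable {V : Type u} {Γ : SimpleGraph V}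

/-- Every edge of `Γ` joining `E` to its complement has both endpoints in `K`. -/
def CutBy (Γ : SimpleGraph V) (K E : Set V) : Prop :=
  ∀ u v, Γ.Adj u v → u ∈ E → v ∉ E → u ∈ K ∧ v ∈ K

theorem CutBy.compl {K E : Set V} (h : Γ.CutBy K E) : Γ.CutBy K Eᶜ := fun u v huv hu hv =>
  (h v u huv.symm (not_not.mp hv) hu).symm

theorem CutBy.mono {K L E : Set V} (h : Γ.CutBy K E) (hKL : K ⊆ L) : Γ.CutBy L E :=
  fun u v huv hu hv => ⟨hKL (h u v huv hu hv).1, hKL (h u v huv hu hv).2⟩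

theorem CutBy.inter {K L E F : Set V} (hE : Γ.CutBy K E) (hF : Γ.CutBy L F) :
    Γ.CutBy (K ∪ L) (E ∩ F) := fun u v huv hu hv => by
  by_cases hvE : v ∈ E
  · exact hF.mono Set.subset_union_right u v huv hu.2 fun hvF => hv ⟨hvE, hvF⟩
  · exact hE.mono Set.subset_union_left u v huv hu.1 hvE

theorem mem_iff_of_reachable_induce {L E : Set V} {x y : L} (h : (Γ.induce L).Reachable x y)
    (hE : ∀ u ∈ L, ∀ v ∈ L, Γ.Adj u v → (u ∈ E ↔ v ∈ E)) : (x : V) ∈ E ↔ (y : V) ∈ E := by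
  obtain ⟨p⟩ := h
  induction p with
  | nil => rfl
  | cons a _ ih => exact (hE _ (Subtype.prop _) _ (Subtype.prop _) a).trans ih

theorem CutBy.mem_iff_of_adj {K E : Set V} (h : Γ.CutBy K E) {u v : V} (huv : Γ.Adj u v)
    (hu : u ∉ K ∨ v ∉ K) : u ∈ E ↔ v ∈ E := by
  by_contra hne
  by_cases huE : u ∈ E
  · have := h u v huv huE (by tauto)
    tauto
  · have := h v u huv.symm (by tauto) huE
    tauto

/-- A connected set of vertices missing `K` is on one side of a set cut by `K`. -/
theorem CutBy.mem_iff_of_preconnected {K E L : Set V} (h : Γ.CutBy K E)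
    (hL : (Γ.induce L).Preconnected) (hKL : Disjoint L K) {x y : V} (hx : x ∈ L) (hy : y ∈ L) :
    x ∈ E ↔ y ∈ E :=
  mem_iff_of_reachable_induce (hL ⟨x, hx⟩ ⟨y, hy⟩) fun _ hu _ _ huv =>
    h.mem_iff_of_adj huv (Or.inl (Set.disjoint_left.mp hKL hu))

theorem CutBy.component_subset {K E : Set V} (h : Γ.CutBy K E) (D : Γ.ComponentCompl K)
    {x : V} (hx : x ∈ D) (hxE : x ∈ E) : (D : Set V) ⊆ E := by
  rintro y ⟨hy, hyD⟩
  obtain ⟨hx, hxD⟩ := hx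
  have : (Γ.induce Kᶜ).Reachable ⟨x, hx⟩ ⟨y, hy⟩ :=
    ConnectedComponent.exact (hxD.trans hyD.symm)
  exact (mem_iff_of_reachable_induce this fun u hu v _ huv =>
    h.mem_iff_of_adj huv (Or.inl hu)).mp hxE

/-- The component of the complement of `K` containing the end `e`. -/
def endComponent (e : Γ.end) (K : Finset V) : Γ.ComponentCompl K := e.1 (Opposite.op K)

/-- The component sets are finite, so their inverse system is Mittag-Leffler and every element of an
eventual range extends to a section; infinite components are exactly those in the eventual range. -/
theorem exists_endComponent_eq [LocallyFinite Γ] (hΓ : Γ.Preconnected) (K : Finset V)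
    (D : Γ.ComponentCompl K) (hD : D.supp.Infinite) :
    ∃ e : Γ.end, endComponent e K = D := by
  have : Fact Γ.Preconnected := ⟨hΓ⟩
  have : Infinite V := Set.infinite_coe_iff.mpr hD |>.of_injective _ Subtype.val_injective
  have hfin (j) : Finite (Γ.componentComplFunctor.obj j) := Γ.componentCompl_finite j.unop
  have hne (j) : Nonempty (Γ.componentComplFunctor.obj j) :=
    Γ.componentCompl_nonempty_of_infinite j.unop
  have hML : Γ.componentComplFunctor.IsMittagLeffler :=
    Γ.componentComplFunctor.isMittagLeffler_of_exists_finite_range fun j =>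
      ⟨j, CategoryTheory.CategoryStruct.id j, Set.toFinite _⟩
  have hne' := Γ.componentComplFunctor.toEventualRanges_nonempty hML
  obtain ⟨s, hs⟩ := Γ.componentComplFunctor.toEventualRanges.eval_section_surjective_of_surjective
    (Γ.componentComplFunctor.surjective_toEventualRanges hML) (Opposite.op K)
    ⟨D, (Γ.infinite_iff_in_eventualRange (K := Opposite.op K) D).mp hD⟩
  exact ⟨Γ.componentComplFunctor.toEventualRangesSectionsEquiv s, congrArg Subtype.val hs⟩

theorem endComponent_hom (e : Γ.end) {K L : Finset V} (h : K ⊆ L) :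
    (endComponent e L).hom h = endComponent e K :=
  e.2 (CategoryTheory.opHomOfLE h)

theorem endComponent_infinite (e : Γ.end) (K : Finset V) :
    (endComponent e K).supp.Infinite :=
  (ComponentCompl.infinite_iff_in_all_ranges (K := K) (endComponent e K)).mpr fun L h =>
    ⟨endComponent e L, endComponent_hom e h⟩

/-- An infinite set of vertices cut by a finite set contains an end. -/
theorem CutBy.exists_end [LocallyFinite Γ] (hΓ : Γ.Preconnected) {K : Finset V} {E : Set V}
    (h : Γ.CutBy K E) (hE : E.Infinite) :
    ∃ e : Γ.end, (endComponent e K : Set V) ⊆ E := by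
  have : Fact Γ.Preconnected := ⟨hΓ⟩
  by_contra! hcon
  have hfin : Finite (Γ.ComponentCompl K) := Γ.componentCompl_finite K
  have hsub : E ⊆ K ∪ ⋃ D : {D : Γ.ComponentCompl K // (D : Set V) ⊆ E}, (D.1 : Set V) := by
    intro x hx
    by_cases hxK : x ∈ (K : Set V)
    · exact Or.inl hxK
    · exact Or.inr (Set.mem_iUnion.mpr ⟨⟨Γ.componentComplMk hxK,
        h.component_subset _ (Γ.componentComplMk_mem hxK) hx⟩, Γ.componentComplMk_mem hxK⟩)
  refine hE ((K.finite_toSet.union (Set.finite_iUnion fun D => ?_)).subset hsub)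
  by_contra hD
  obtain ⟨e, he⟩ := exists_endComponent_eq hΓ K D.1 hD
  exact hcon e (he ▸ D.2)

/-- Distinct ends are separated by every large enough finite set. -/
theorem endComponent_ne_of_subset {e f : Γ.end} {K L : Finset V} (hKL : K ⊆ L)
    (h : endComponent e K ≠ endComponent f K) :
    endComponent e L ≠ endComponent f L := fun hL => h <| by
  rw [← endComponent_hom e hKL, ← endComponent_hom f hKL, hL]

theorem exists_endComponent_ne {e f : Γ.end} (h : e ≠ f) :
    ∃ K : Finset V, endComponent e K ≠ endComponent f K := by
  by_contra! hcon
  exact h (Subtype.ext (funext fun K => hcon K.unop))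

theorem cutBy_component {K : Set V} (D : Γ.ComponentCompl K) :
    Γ.CutBy {v | v ∈ K ∨ ∃ w ∈ K, Γ.Adj w v} D := fun u v huv hu hv => by
  have hvK : v ∈ K := by
    by_contra hvK
    exact hv (ComponentCompl.mem_of_adj u v hu hvK huv)
  exact ⟨Or.inr ⟨v, hvK, huv.symm⟩, Or.inl hvK⟩

/-- A graph with exactly two ends has no three disjoint infinite sets cut by a finite set. -/
theorem not_infinite_of_card_end_eq_two [LocallyFinite Γ] (hΓ : Γ.Preconnected)
    (h2 : ENat.card Γ.end = 2) {K : Set V} (hK : K.Finite) {A B C : Set V}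
    (hA : Γ.CutBy K A) (hB : Γ.CutBy K B) (hC : Γ.CutBy K C) (hAB : Disjoint A B)
    (hAC : Disjoint A C) (hBC : Disjoint B C) (hAi : A.Infinite) (hBi : B.Infinite) :
    C.Finite := by
  by_contra hCi
  lift K to Finset V using hK
  obtain ⟨a, ha⟩ := hA.exists_end hΓ hAi
  obtain ⟨b, hb⟩ := hB.exists_end hΓ hBi
  obtain ⟨c, hc⟩ := hC.exists_end hΓ hCi
  have key {A B : Set V} (hAB : Disjoint A B) {a b : Γ.end}
      (ha : (endComponent a K : Set V) ⊆ A)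
      (hb : (endComponent b K : Set V) ⊆ B) : a ≠ b := by
    rintro rfl
    obtain ⟨x, hx⟩ := (endComponent_infinite a K).nonempty
    exact Set.disjoint_left.mp hAB (ha hx) (hb hx)
  rw [ENat.card_coe_set_eq, Set.encard_eq_two] at h2
  obtain ⟨x, y, -, hxy⟩ := h2
  have h (e : Γ.end) : e.val = x ∨ e.val = y := by
    have : e.val ∈ Γ.end := Subtype.mem e
    exact (Set.ext_iff.mp hxy _).mp this
  have h1 := key hAB ha hb
  have h2 := key hAC ha hc
  have h3 := key hBC hb hc
  rw [Ne, Subtype.ext_iff] at h1 h2 h3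
  have ha := h a
  have hb := h b
  have hc := h c
  grind

theorem infinite_of_card_end_eq_two (h2 : ENat.card Γ.end = 2) : Infinite V := by
  by_contra hV
  rw [not_infinite_iff_finite] at hV
  have : Nonempty Γ.end := by
    rw [← ENat.card_ne_zero_iff_nonempty, h2]
    simp
  obtain ⟨e⟩ := this
  exact endComponent_infinite e ∅ (Set.toFinite _)

/-- A graph with two ends has an infinite, co-infinite set of vertices cut by a finite set. -/
theorem exists_cutBy_of_card_end_eq_two [LocallyFinite Γ] (h2 : ENat.card Γ.end = 2) :
    ∃ (K E : Set V), K.Finite ∧ Γ.CutBy K E ∧ E.Infinite ∧ Eᶜ.Infinite := by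
  classical
  have : Nontrivial Γ.end := by
    rw [← ENat.one_lt_card_iff_nontrivial, h2]
    exact Nat.one_lt_ofNat
  obtain ⟨e, f, hef⟩ := exists_pair_ne Γ.end
  obtain ⟨K, hK⟩ := exists_endComponent_ne hef
  refine ⟨_, _, ?_, cutBy_component (endComponent e K), endComponent_infinite e K,
    (endComponent_infinite f K).mono ?_⟩
  · refine (K.finite_toSet.union (K.finite_toSet.biUnion fun w _ =>
      (Set.toFinite (Γ.neighborSet w)))).subset ?_
    rintro v (hv | ⟨w, hw, hwv⟩)
    · exact Or.inl hv
    · exact Or.inr (Set.mem_biUnion hw hwv)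
  · exact fun x hx hx' => Set.disjoint_left.mp (ComponentCompl.pairwise_disjoint hK) hx' hx

/-- A graph has exactly two ends if it has an infinite, co-infinite set of vertices cut by a finite
set, and if outside every finite set almost all vertices lie in the union of two components. -/
theorem card_end_eq_two [LocallyFinite Γ] (hΓ : Γ.Preconnected) {K : Set V} (hK : K.Finite)
    {E : Set V} (hKE : Γ.CutBy K E) (hE : E.Infinite) (hE' : Eᶜ.Infinite)
    (h : ∀ K : Finset V, ∃ C D : Γ.ComponentCompl K, ((C ∪ D : Set V)ᶜ).Finite) :
    ENat.card Γ.end = 2 := by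
  classical
  lift K to Finset V using hK
  apply le_antisymm
  · by_contra! hcon
    have h3 : (3 : ℕ∞) ≤ Γ.end.encard := Order.add_one_le_of_lt hcon
    obtain ⟨s, hs, hs3⟩ := Set.exists_subset_encard_eq h3
    obtain ⟨x, y, z, hxy, hxz, hyz, rfl⟩ := Set.encard_eq_three.mp hs3
    lift x to Γ.end using hs (by simp)
    lift y to Γ.end using hs (by simp)
    lift z to Γ.end using hs (by simp)
    rw [Ne, ← Subtype.ext_iff] at hxy hxz hyz
    obtain ⟨K₁, h₁⟩ := exists_endComponent_ne hxy
    obtain ⟨K₂, h₂⟩ := exists_endComponent_ne hxz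
    obtain ⟨K₃, h₃⟩ := exists_endComponent_ne hyz
    -- `L` separates all three ends, but each of their components is infinite, so meets `C ∪ D` and
    -- equals `C` or `D`.
    let L := K₁ ∪ K₂ ∪ K₃
    obtain ⟨C, D, hCD⟩ := h L
    have key (e : Γ.end) : endComponent e L = C ∨ endComponent e L = D := by
      obtain ⟨v, hv, hvCD⟩ := ((endComponent_infinite e L).sdiff hCD).nonempty
      rw [Set.mem_compl_iff, not_not] at hvCD
      refine hvCD.imp (fun hC => ?_) fun hC => ?_ <;> by_contra hne <;>
        exact Set.disjoint_left.mp (ComponentCompl.pairwise_disjoint hne) hv hC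
    have h₁ := endComponent_ne_of_subset (L := L) (by intro; simp +contextual [L]) h₁
    have h₂ := endComponent_ne_of_subset (L := L) (by intro; simp +contextual [L]) h₂
    have h₃ := endComponent_ne_of_subset (L := L) (by intro; simp +contextual [L]) h₃
    have hx := key x
    have hy := key y
    have hz := key z
    grind
  · obtain ⟨e, he⟩ := hKE.exists_end hΓ hE
    obtain ⟨f, hf⟩ := hKE.compl.exists_end hΓ hE'
    have : Nontrivial Γ.end := ⟨e, f, by
      rintro rfl
      obtain ⟨x, hx⟩ := (endComponent_infinite e K).nonempty
      exact hf hx (he hx)⟩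
    exact Order.add_one_le_of_lt ((ENat.one_lt_card_iff_nontrivial _).mpr this)

end SimpleGraph
-- Cayley graphs and translates of cut sets
open scoped Pointwise symmDiff

namespace SimpleGraph

variable {V : Type u} {Γ : SimpleGraph V}

theorem eq_empty_or_univ_of_cutBy_empty (hΓ : Γ.Preconnected) {E : Set V} (h : Γ.CutBy ∅ E) :
    E = ∅ ∨ E = Set.univ := by
  rcases E.eq_empty_or_nonempty with hE | ⟨x, hx⟩
  · exact Or.inl hE
  · refine Or.inr (Set.eq_univ_of_forall fun y => ?_)
    obtain ⟨p⟩ := hΓ x y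
    by_contra hy
    obtain ⟨d, -, h1, h2⟩ := p.exists_boundary_dart E hx hy
    exact (h _ _ d.adj h1 h2).1

/-- An edge leaving `A ∩ B` leaves `A` or `B`, so its inner endpoint would lie in `K ∩ B` or `L ∩
A`. -/
theorem CutBy.inter_eq_empty_or_univ (hΓ : Γ.Preconnected) {K L A B : Set V}
    (hA : Γ.CutBy K A) (hB : Γ.CutBy L B) (hKB : Disjoint K B) (hLA : Disjoint L A) :
    A ∩ B = ∅ ∨ A ∩ B = Set.univ := by
  refine eq_empty_or_univ_of_cutBy_empty hΓ fun u v huv hu hv => ?_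
  by_cases hvA : v ∈ A
  · exact (Set.disjoint_left.mp hLA (hB u v huv hu.2 fun hvB => hv ⟨hvA, hvB⟩).1 hu.1).elim
  · exact (Set.disjoint_left.mp hKB (hA u v huv hu.1 hvA).1 hu.2).elim

theorem CutBy.exists_mem (hΓ : Γ.Preconnected) {K E : Set V} (h : Γ.CutBy K E)
    (hE : E.Nonempty) (hE' : Eᶜ.Nonempty) : ∃ k ∈ K, k ∈ E := by
  obtain ⟨x, hx⟩ := hE
  obtain ⟨y, hy⟩ := hE'
  obtain ⟨p⟩ := hΓ x y
  obtain ⟨d, -, h1, h2⟩ := p.exists_boundary_dart E hx hy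
  exact ⟨_, (h _ _ d.adj h1 h2).1, h1⟩

section Cayley

variable {G : Type u} [Group G] {S : Set G}

theorem mulCayley_preconnected (hS : Subgroup.closure S = ⊤) :
    (mulCayley S).Preconnected := by
  have hstep (x s : G) (hs : s ∈ S) : (mulCayley S).Reachable x (x * s) := by
    by_cases h : x = x * s
    · rw [← h]
    · exact Adj.reachable ((mulCayley_adj S _ _).mpr ⟨h, Or.inl (by simpa using hs)⟩)
  have h1 (x : G) : (mulCayley S).Reachable 1 x := by
    have hx : x ∈ Subgroup.closure S := hS ▸ Subgroup.mem_top x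
    induction hx using Subgroup.closure_induction_right with
    | one => rfl
    | mul_right x _ s hs ih => exact ih.trans (hstep x s hs)
    | mul_inv_cancel x _ s hs ih =>
      have := hstep (x * s⁻¹) s hs
      rw [inv_mul_cancel_right] at this
      exact ih.trans this.symm
  exact fun x y => (h1 x).symm.trans (h1 y)

/-- The Cayley graph of a finite set is locally finite. -/
@[reducible]
noncomputable def mulCayleyLocallyFinite (hS : S.Finite) : (mulCayley S).LocallyFinite := fun x =>
  Set.Finite.fintype <| ((hS.image (x * ·)).union (hS.image (x * ·⁻¹))).subset fun y hy => by
    obtain ⟨-, h | h⟩ := (mulCayley_adj S _ _).mp hy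
    · exact Or.inl ⟨_, h, by simp⟩
    · exact Or.inr ⟨_, h, by simp⟩

theorem CutBy.smul {K E : Set G} (h : (mulCayley S).CutBy K E) (g : G) :
    (mulCayley S).CutBy (g • K) (g • E) := fun u v huv hu hv => by
  simp only [Set.mem_smul_set_iff_inv_smul_mem, smul_eq_mul] at hu hv ⊢
  exact h _ _ (mulCayley_adj_mul_iff_right.mpr huv) hu hv

theorem preconnected_induce_smul {K : Set G} (h : ((mulCayley S).induce K).Preconnected) (g : G) :
    ((mulCayley S).induce (g • K)).Preconnected := by
  let f : (mulCayley S).induce K →g (mulCayley S).induce (g • K) :=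
    { toFun := fun x => ⟨g * x, Set.smul_mem_smul_set x.2⟩
      map_rel' := fun {x y} hxy => mulCayley_adj_mul_iff_right.mpr hxy }
  rintro ⟨_, x, hx, rfl⟩ ⟨_, y, hy, rfl⟩
  exact (h ⟨x, hx⟩ ⟨y, hy⟩).map f

end Cayley

end SimpleGraph

/-! ### Almost invariant sets and the shift homomorphism -/

namespace AlmostInvariant

variable {X : Type u} {G : Type u} [Group G]

theorem finite_symmDiff_trans {A B C : Set X} (h : (A ∆ B).Finite) (h' : (B ∆ C).Finite) :
    (A ∆ C).Finite := (h.union h').subset (symmDiff_triangle A B C)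

theorem finite_symmDiff_smul {A B : Set G} (h : (A ∆ B).Finite) (g : G) :
    ((g • A) ∆ (g • B)).Finite := by
  rw [← Set.smul_set_symmDiff]
  exact h.smul_set

/-- The subgroup of all `g` for which `E` and `g • E` differ by a finite set. -/
def almostStabilizer (E : Set G) : Subgroup G where
  carrier := {g | (E ∆ (g • E)).Finite}
  one_mem' := by simp
  mul_mem' {g h} hg hh := by
    simp only [Set.mem_ofPred_eq] at hg hh ⊢
    rw [mul_smul]
    exact finite_symmDiff_trans hg (finite_symmDiff_smul hh g)
  inv_mem' {g} hg := by
    simp only [Set.mem_ofPred_eq] at hg ⊢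
    have := finite_symmDiff_smul hg g⁻¹
    rwa [inv_smul_smul, symmDiff_comm] at this

theorem mem_almostStabilizer {E : Set G} {g : G} :
    g ∈ almostStabilizer E ↔ (E ∆ (g • E)).Finite := Iff.rfl

/-- The difference of the indicator functions of `A` and `B`. -/
noncomputable def indicatorDiff (A B : Set X) (x : X) : ℤ := A.indicator 1 x - B.indicator 1 x

theorem support_indicatorDiff (A B : Set X) :
    Function.support (indicatorDiff A B) = A ∆ B := by
  ext x
  by_cases hA : x ∈ A <;> by_cases hB : x ∈ B <;>
    simp [indicatorDiff, hA, hB, Set.mem_symmDiff]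

theorem hasFiniteSupport_indicatorDiff {A B : Set X} (h : (A ∆ B).Finite) :
    (indicatorDiff A B).HasFiniteSupport := by
  rwa [Function.HasFiniteSupport, support_indicatorDiff]

/-- The number of elements of `A` minus the number of elements of `B`, if they differ by a
finite set. -/
noncomputable def relCard (A B : Set X) : ℤ := ∑ᶠ x, indicatorDiff A B x

theorem relCard_add {A B C : Set X} (h : (A ∆ B).Finite) (h' : (B ∆ C).Finite) :
    relCard A B + relCard B C = relCard A C := by
  rw [relCard, relCard, relCard, ← finsum_add_distrib]
  · simp [indicatorDiff]
  · exact hasFiniteSupport_indicatorDiff h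
  · exact hasFiniteSupport_indicatorDiff h'

theorem relCard_smul (A B : Set G) (g : G) : relCard (g • A) (g • B) = relCard A B := by
  rw [relCard, relCard, ← finsum_comp_equiv (Equiv.mulLeft g)]
  refine finsum_congr fun x => ?_
  have (A : Set G) : (g • A).indicator (1 : G → ℤ) (g * x) = A.indicator 1 x := by
    have h : g * x ∈ g • A ↔ x ∈ A := Set.smul_mem_smul_set_iff
    by_cases hx : x ∈ A
    · rw [Set.indicator_of_mem hx, Set.indicator_of_mem (h.mpr hx)]
      rfl
    · rw [Set.indicator_of_notMem hx, Set.indicator_of_notMem (mt h.mp hx)]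
  rw [indicatorDiff, indicatorDiff, Equiv.coe_mulLeft, this, this]

theorem relCard_neg (A B : Set X) : relCard B A = - relCard A B := by
  rw [relCard, relCard, ← finsum_neg_distrib]
  simp [indicatorDiff]

theorem relCard_pos {A B : Set X} (h : (A ∆ B).Finite) (hBA : B ⊂ A) : 0 < relCard A B := by
  obtain ⟨x, hxA, hxB⟩ := Set.exists_of_ssubset hBA
  refine finsum_pos (fun y => ?_) ⟨x, ?_⟩ ?_
  · by_cases hB : y ∈ B
    · simp [indicatorDiff, hB, hBA.1 hB]
    · by_cases hA : y ∈ A <;> simp [indicatorDiff, hA, hB]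
  · simp [indicatorDiff, hxA, hxB]
  · exact hasFiniteSupport_indicatorDiff h

/-- The homomorphism measuring by how much an element of the almost stabilizer shifts `E`. -/
noncomputable def shift (E : Set G) : almostStabilizer E →* Multiplicative ℤ where
  toFun g := Multiplicative.ofAdd (relCard E ((g : G) • E))
  map_one' := by
    have : indicatorDiff E E = 0 := by ext; simp [indicatorDiff]
    simp [relCard, this]
  map_mul' g h := by
    -- Count from `E` to `g • E` and on to `g • h • E`; translation invariance turns the second
    -- count into the shift of `h`.
    rw [← ofAdd_add, ← relCard_smul E ((h : G) • E) g, relCard_add g.2, Subgroup.coe_mul, mul_smul]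
    exact finite_symmDiff_smul h.2 g

open SimpleGraph

variable {S : Set G}

/-- Being connected and disjoint, `g • K` lies on one side of `E` and `K` on one side of `g • E`.
The corner opposite to both meets no boundary, so it is empty. Two of the four cases give nesting;
the other two contradict that `E` and `g • E` are almost equal. -/
theorem ssubset_or_ssubset (hΓ : (mulCayley S).Preconnected) {K E : Set G}
    (hE : (mulCayley S).CutBy K E) (hK1 : 1 ∈ K) (hK : ((mulCayley S).induce K).Preconnected)
    (hEi : E.Infinite) (hEi' : Eᶜ.Infinite) {g : G} (hg : (E ∆ (g • E)).Finite)
    (hgK : Disjoint (g • K) K) : g • E ⊂ E ∨ E ⊂ g • E := by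
  have hgE := hE.smul g
  have hg1 : g ∈ g • K := ⟨1, hK1, by simp⟩
  have h1 {x : G} (hx : x ∈ g • K) : x ∈ E ↔ g ∈ E :=
    hE.mem_iff_of_preconnected (preconnected_induce_smul hK g) hgK hx hg1
  have h2 {x : G} (hx : x ∈ K) : x ∈ g • E ↔ 1 ∈ g • E :=
    hgE.mem_iff_of_preconnected hK hgK.symm hx hK1
  -- Either `k` or `g • k` witnesses that the inclusion is strict.
  obtain ⟨k, hkK, hkE⟩ := hE.exists_mem hΓ hEi.nonempty hEi'.nonempty
  by_cases hgE' : g ∈ E <;> by_cases h1E : 1 ∈ g • E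
  · have := hE.compl.inter_eq_empty_or_univ hΓ hgE.compl
      (Set.disjoint_left.mpr fun x hx hx' => hx' ((h2 hx).mpr h1E))
      (Set.disjoint_left.mpr fun x hx hx' => hx' ((h1 hx).mpr hgE'))
    rcases this with h | h
    · refine (hEi' (hg.subset fun x hx => Or.inr ⟨?_, hx⟩)).elim
      by_contra hx'
      exact (h ▸ ⟨hx, hx'⟩ : x ∈ (∅ : Set G))
    · exact ((h ▸ Set.mem_univ g : g ∈ Eᶜ ∩ (g • E)ᶜ).1 hgE').elim
  · have := hE.compl.inter_eq_empty_or_univ hΓ hgE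
      (Set.disjoint_left.mpr fun x hx hx' => h1E ((h2 hx).mp hx'))
      (Set.disjoint_left.mpr fun x hx hx' => hx' ((h1 hx).mpr hgE'))
    rcases this with h | h
    · refine Or.inl (Set.ssubset_iff_of_subset (fun x hx => ?_) |>.mpr
        ⟨k, hkE, fun hk => h1E ((h2 hkK).mp hk)⟩)
      by_contra hx'
      exact (h ▸ ⟨hx', hx⟩ : x ∈ (∅ : Set G))
    · exact ((h ▸ Set.mem_univ g : g ∈ Eᶜ ∩ (g • E)).1 hgE').elim
  · have := hE.inter_eq_empty_or_univ hΓ hgE.compl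
      (Set.disjoint_left.mpr fun x hx hx' => hx' ((h2 hx).mpr h1E))
      (Set.disjoint_left.mpr fun x hx hx' => hgE' ((h1 hx).mp hx'))
    rcases this with h | h
    · refine Or.inr (Set.ssubset_iff_of_subset (fun x hx => ?_) |>.mpr
        ⟨g • k, Set.smul_mem_smul_set hkE,
          fun hk => hgE' ((h1 (Set.smul_mem_smul_set hkK)).mp hk)⟩)
      by_contra hx'
      exact (h ▸ ⟨hx, hx'⟩ : x ∈ (∅ : Set G))
    · exact (hgE' (h ▸ Set.mem_univ g : g ∈ E ∩ (g • E)ᶜ).1).elim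
  · have := hE.inter_eq_empty_or_univ hΓ hgE
      (Set.disjoint_left.mpr fun x hx hx' => h1E ((h2 hx).mp hx'))
      (Set.disjoint_left.mpr fun x hx hx' => hgE' ((h1 hx).mp hx'))
    rcases this with h | h
    · refine (hEi (hg.subset fun x hx => Or.inl ⟨hx, fun hx' => ?_⟩)).elim
      exact (h ▸ ⟨hx, hx'⟩ : x ∈ (∅ : Set G))
    · exact (hgE' (h ▸ Set.mem_univ g : g ∈ E ∩ (g • E)).1).elim

/-- Outside the finite set `K * K⁻¹`, `g • K` misses `K`, and strict nesting makes the shift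
nonzero. -/
theorem finite_ker_shift (hΓ : (mulCayley S).Preconnected) {K E : Set G} (hKf : K.Finite)
    (hE : (mulCayley S).CutBy K E) (hK1 : 1 ∈ K) (hK : ((mulCayley S).induce K).Preconnected)
    (hEi : E.Infinite) (hEi' : Eᶜ.Infinite) : Finite (shift E).ker := by
  have hsub : (fun g : (shift E).ker => (g : G)) '' Set.univ ⊆ K * K⁻¹ := by
    rintro _ ⟨⟨⟨g, hg⟩, hgs⟩, -, rfl⟩
    by_contra hgK
    have hdis : Disjoint (g • K) K := by
      rw [Set.disjoint_left]
      rintro _ ⟨k, hk, rfl⟩ hk'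
      exact hgK ⟨_, hk', k⁻¹, Set.inv_mem_inv.mpr hk, by simp⟩
    have h0 : relCard E (g • E) = 0 := congrArg Multiplicative.toAdd hgs
    rcases ssubset_or_ssubset hΓ hE hK1 hK hEi hEi' hg hdis with h | h
    · exact (relCard_pos hg h).ne' h0
    · have := relCard_pos (by rwa [symmDiff_comm]) h
      rw [relCard_neg, h0] at this
      simp at this
  have := (hKf.mul hKf.inv).subset hsub
  exact Set.finite_univ_iff.mp (this.of_finite_image
    (Subtype.val_injective.comp Subtype.val_injective).injOn)

/-- Of the four corners of `E` and `g • E`, at most two are infinite. As both sets and their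
complements are infinite, the finite corners are exactly one opposite pair. -/
theorem finite_symmDiff_or (hS : S.Finite) (hΓ : (mulCayley S).Preconnected)
    (h2 : ENat.card (mulCayley S).end = 2) {K E : Set G} (hKf : K.Finite)
    (hE : (mulCayley S).CutBy K E) (hEi : E.Infinite) (hEi' : Eᶜ.Infinite) (g : G) :
    (E ∆ (g • E)).Finite ∨ (Eᶜ ∆ (g • E)).Finite := by
  have := mulCayleyLocallyFinite hS
  have hgi : (g • E).Infinite := hEi.smul_set
  have hgi' : ((g • E)ᶜ).Infinite := by
    rw [← Set.smul_set_compl]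
    exact hEi'.smul_set
  have hK' : (K ∪ g • K).Finite := hKf.union hKf.smul_set
  have hg := hE.smul g
  have c1 := hE.inter hg
  have c2 := hE.inter hg.compl
  have c3 := hE.compl.inter hg
  have c4 := hE.compl.inter hg.compl
  have d12 : Disjoint (E ∩ g • E) (E ∩ (g • E)ᶜ) := by grind
  have d13 : Disjoint (E ∩ g • E) (Eᶜ ∩ g • E) := by grind
  have d14 : Disjoint (E ∩ g • E) (Eᶜ ∩ (g • E)ᶜ) := by grind
  have d23 : Disjoint (E ∩ (g • E)ᶜ) (Eᶜ ∩ g • E) := by grind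
  have d24 : Disjoint (E ∩ (g • E)ᶜ) (Eᶜ ∩ (g • E)ᶜ) := by grind
  have d34 : Disjoint (Eᶜ ∩ g • E) (Eᶜ ∩ (g • E)ᶜ) := by grind
  have t123 := not_infinite_of_card_end_eq_two hΓ h2 hK' c1 c2 c3 d12 d13 d23
  have t124 := not_infinite_of_card_end_eq_two hΓ h2 hK' c1 c2 c4 d12 d14 d24
  have t134 := not_infinite_of_card_end_eq_two hΓ h2 hK' c1 c3 c4 d13 d14 d34
  have t234 := not_infinite_of_card_end_eq_two hΓ h2 hK' c2 c3 c4 d23 d24 d34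
  have f12 : ¬ ((E ∩ g • E).Finite ∧ (E ∩ (g • E)ᶜ).Finite) := fun h =>
    hEi ((h.1.union h.2).subset fun x hx => by by_cases hx' : x ∈ g • E <;> simp_all)
  have f34 : ¬ ((Eᶜ ∩ g • E).Finite ∧ (Eᶜ ∩ (g • E)ᶜ).Finite) := fun h =>
    hEi' ((h.1.union h.2).subset fun x hx => by
      by_cases hx' : x ∈ g • E <;> simp_all)
  have f13 : ¬ ((E ∩ g • E).Finite ∧ (Eᶜ ∩ g • E).Finite) := fun h =>
    hgi ((h.1.union h.2).subset fun x hx => by by_cases hx' : x ∈ E <;> simp [hx, hx'])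
  have f24 : ¬ ((E ∩ (g • E)ᶜ).Finite ∧ (Eᶜ ∩ (g • E)ᶜ).Finite) := fun h =>
    hgi' ((h.1.union h.2).subset fun x hx => by
      by_cases hx' : x ∈ E <;> simp_all)
  have key : ((E ∩ (g • E)ᶜ).Finite ∧ (Eᶜ ∩ g • E).Finite) ∨
      ((E ∩ g • E).Finite ∧ (Eᶜ ∩ (g • E)ᶜ).Finite) := by
    by_cases p : (E ∩ g • E).Finite
    · have q : ¬ (E ∩ (g • E)ᶜ).Finite := fun q => f12 ⟨p, q⟩
      have r : ¬ (Eᶜ ∩ g • E).Finite := fun r => f13 ⟨p, r⟩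
      exact Or.inr ⟨p, t234 q r⟩
    · by_cases q : (E ∩ (g • E)ᶜ).Finite
      · have t : ¬ (Eᶜ ∩ (g • E)ᶜ).Finite := fun t => f24 ⟨q, t⟩
        exact Or.inl ⟨q, not_not.mp fun r => t (t134 p r)⟩
      · exact (f34 ⟨t123 p q, t124 p q⟩).elim
  refine key.imp (fun h => (h.1.union h.2).subset ?_) fun h => (h.1.union h.2).subset ?_
  · rintro x (hx | hx)
    · exact Or.inl hx
    · exact Or.inr hx.symm
  · rintro x (hx | hx)
    · exact Or.inr hx
    · exact Or.inl ⟨not_not.mp hx.2, hx.1⟩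

/-- Elements outside the almost stabilizer all carry `E` almost onto `Eᶜ`, so they form at most one
coset. -/
theorem finiteIndex_almostStabilizer {E : Set G}
    (h : ∀ g : G, (E ∆ (g • E)).Finite ∨ (Eᶜ ∆ (g • E)).Finite) :
    (almostStabilizer E).FiniteIndex := by
  have hmk {g k : G} (hg : g ∉ almostStabilizer E) (hk : k ∉ almostStabilizer E) :
      (g : G ⧸ almostStabilizer E) = k := by
    rw [QuotientGroup.eq, mem_almostStabilizer]
    have hg := (h g).resolve_left hg
    have hk := (h k).resolve_left hk
    rw [symmDiff_comm] at hg
    have := finite_symmDiff_smul (finite_symmDiff_trans hg hk) g⁻¹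
    rwa [inv_smul_smul, ← mul_smul] at this
  have : Finite (G ⧸ almostStabilizer E) := by
    by_cases hall : ∃ k, k ∉ almostStabilizer E
    · obtain ⟨k, hk⟩ := hall
      refine Set.finite_univ_iff.mp ((Set.toFinite {((1 : G) : G ⧸ almostStabilizer E),
        (k : G ⧸ almostStabilizer E)}).subset ?_)
      rintro x -
      induction x using QuotientGroup.induction_on with
      | H g =>
      by_cases hg : g ∈ almostStabilizer E
      · left
        rw [QuotientGroup.eq]
        simpa using hg
      · exact Or.inr (hmk hg hk)
    · push Not at hall
      have : Subsingleton (G ⧸ almostStabilizer E) := ⟨fun x y => by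
        induction x using QuotientGroup.induction_on
        induction y using QuotientGroup.induction_on
        rw [QuotientGroup.eq]
        exact hall _⟩
      infer_instance
  exact Subgroup.finiteIndex_of_finite_quotient

end AlmostInvariant

/-! ### Two ends imply virtually cyclic -/

theorem exists_finiteIndex_zpowers_of_finite_ker {P : Type u} [Group P]
    (f : P →* Multiplicative ℤ) [Finite f.ker] : ∃ a : P, (Subgroup.zpowers a).FiniteIndex := by
  obtain ⟨⟨_, a, rfl⟩, ha⟩ := IsCyclic.exists_generator (α := f.range)
  refine ⟨a, ?_⟩
  have hsurj : Function.Surjective (fun k : f.ker => ((k : P) : P ⧸ Subgroup.zpowers a)) := by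
    intro x
    induction x using QuotientGroup.induction_on with
    | H x =>
    obtain ⟨n, hn⟩ := Subgroup.mem_zpowers_iff.mp (ha ⟨f x, x, rfl⟩)
    have hn : f a ^ n = f x := congrArg Subtype.val hn
    refine ⟨⟨x * a ^ (-n), by simp [MonoidHom.mem_ker, hn]⟩, ?_⟩
    rw [QuotientGroup.eq]
    exact ⟨n, by simp⟩
  have := Finite.of_surjective _ hsurj
  exact Subgroup.finiteIndex_of_finite_quotient

theorem exists_finiteIndex_zpowers_of_subgroup {G : Type u} [Group G] (P : Subgroup G)
    [P.FiniteIndex] (h : ∃ a : P, (Subgroup.zpowers a).FiniteIndex) :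
    ∃ a : G, (Subgroup.zpowers a).FiniteIndex := by
  obtain ⟨a, ha⟩ := h
  refine ⟨a, ⟨?_⟩⟩
  have : Subgroup.zpowers (a : G) = (Subgroup.zpowers a).map P.subtype := by
    rw [MonoidHom.map_zpowers]
    rfl
  rw [this, Subgroup.index_map_subtype]
  exact mul_ne_zero ha.index_ne_zero Subgroup.FiniteIndex.index_ne_zero

/-- A finitely generated group with two ends is virtually infinite cyclic. -/
theorem exists_finiteIndex_zpowers_of_numEnds_eq_two {G : Type u} [Group G] {S : Set G}
    (hS : S.Finite) (hgen : Subgroup.closure S = ⊤) (h2 : numEnds S = 2) :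
    ∃ a : G, (Subgroup.zpowers a).FiniteIndex := by
  classical
  have := SimpleGraph.mulCayleyLocallyFinite hS
  have hΓ := SimpleGraph.mulCayley_preconnected hgen
  obtain ⟨K₀, E, hK₀, hE, hEi, hEi'⟩ := SimpleGraph.exists_cutBy_of_card_end_eq_two h2
  lift K₀ to Finset G using hK₀
  -- Nesting of translates needs a connected cutting set containing 1.
  obtain ⟨K, hK₀K, hK⟩ := SimpleGraph.extend_finset_to_connected hΓ
    (Finset.insert_nonempty 1 K₀)
  have hE := hE.mono (L := K) fun x hx => hK₀K (Finset.mem_insert_of_mem hx)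
  have := AlmostInvariant.finite_ker_shift hΓ K.finite_toSet hE
    (hK₀K (Finset.mem_insert_self _ _)) hK.preconnected hEi hEi'
  have := AlmostInvariant.finiteIndex_almostStabilizer
    (AlmostInvariant.finite_symmDiff_or hS hΓ h2 K.finite_toSet hE hEi hEi')
  exact exists_finiteIndex_zpowers_of_subgroup _
    (exists_finiteIndex_zpowers_of_finite_ker (AlmostInvariant.shift E))

/-! ### Infinite virtually cyclic groups have two ends -/

theorem zpow_injective_of_finiteIndex_zpowers {G : Type u} [Group G] [Infinite G] {a : G}
    (ha : (Subgroup.zpowers a).FiniteIndex) : Function.Injective fun n : ℤ => a ^ n := by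
  rw [injective_zpow_iff_not_isOfFinOrder]
  intro h
  have : Finite (Subgroup.zpowers a) := (finite_zpowers.mpr h).to_subtype
  have : Finite (G ⧸ Subgroup.zpowers a) := Subgroup.finite_quotient_of_finiteIndex
  have : Finite G := Finite.of_equiv _ (Subgroup.groupEquivQuotientProdSubgroup
    (s := Subgroup.zpowers a)).symm
  exact not_finite G

/-- A subgroup of finite index admits a finite set of right coset representatives. -/
theorem exists_finite_rightCoset_cover {G : Type u} [Group G] (P : Subgroup G) [P.FiniteIndex] :
    ∃ F : Finset G, ∀ x : G, ∃ p ∈ P, ∃ f ∈ F, x = p * f := by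
  classical
  have : Finite (G ⧸ P) := Subgroup.finite_quotient_of_finiteIndex
  have := Fintype.ofFinite (G ⧸ P)
  refine ⟨Finset.univ.image fun q : G ⧸ P => q.out⁻¹, fun x => ?_⟩
  refine ⟨x * ((x⁻¹ : G) : G ⧸ P).out, ?_, _, Finset.mem_image_of_mem _ (Finset.mem_univ
    ((x⁻¹ : G) : G ⧸ P)), by simp⟩
  have : ((x⁻¹ : G) : G ⧸ P) = ((((x⁻¹ : G) : G ⧸ P).out : G) : G ⧸ P) :=
    (QuotientGroup.out_eq' _).symm
  rw [QuotientGroup.eq, inv_inv] at this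
  exact this

namespace SimpleGraph

variable {G : Type u} [Group G] {S : Set G}

/-- The vertices `a ^ n * f` with `n ≥ 0` and `f ∈ F` are cut off by a finite set. -/
theorem exists_cutBy_zpow_mul (hS : S.Finite) {a : G} {F : Finset G}
    (hF : ∀ x : G, ∃ n : ℤ, ∃ f ∈ F, x = a ^ n * f) :
    ∃ K : Set G, K.Finite ∧
      (mulCayley S).CutBy K {x | ∃ n : ℤ, 0 ≤ n ∧ ∃ f ∈ F, x = a ^ n * f} := by
  classical
  choose m r hr hmr using hF
  have hT : (S ∪ S⁻¹).Finite := hS.union hS.inv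
  lift S ∪ S⁻¹ to Finset G using hT with T hTS
  -- the exponents by which a generator can shift an element of `F`
  let I : Finset ℤ := (F ×ˢ T).image fun p => m (p.1 * p.2)
  obtain ⟨b, hb⟩ := I.bddBelow
  -- A generator lowers the exponent by at most `-b`, so only exponents up to `-b` can become
  -- negative.
  let J : Set G := (fun p : ℤ × G => a ^ p.1 * p.2) '' (Set.Icc 0 (-b) ×ˢ (F : Set G))
  have hJ : J.Finite := ((Set.finite_Icc 0 (-b)).prod F.finite_toSet).image _
  refine ⟨J ∪ J * T, hJ.union (hJ.mul T.finite_toSet), ?_⟩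
  rintro u v huv ⟨n, hn, f, hf, rfl⟩ hv
  obtain ⟨t, ht, rfl⟩ : ∃ t ∈ T, v = a ^ n * f * t := by
    refine ⟨(a ^ n * f)⁻¹ * v, ?_, by group⟩
    rw [← Finset.mem_coe, hTS]
    obtain ⟨-, h | h⟩ := (mulCayley_adj S _ _).mp huv
    · exact Or.inl h
    · exact Or.inr (by simpa using h)
  have hJmem : a ^ n * f ∈ J := by
    refine ⟨(n, f), ⟨⟨hn, ?_⟩, hf⟩, rfl⟩
    by_contra hcon
    refine hv ⟨n + m (f * t), ?_, r (f * t), hr _, ?_⟩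
    · have := hb (Finset.mem_coe.mpr (Finset.mem_image_of_mem (fun p : G × G => m (p.1 * p.2))
        (Finset.mk_mem_product hf ht)))
      simp only at this hcon
      omega
    · rw [zpow_add, mul_assoc, mul_assoc, ← hmr]
  exact ⟨Or.inl hJmem, Or.inr (Set.mul_mem_mul hJmem ht)⟩

/-- Far away translates of a finite set miss a given finite set. -/
theorem exists_disjoint_zpow_smul {a : G} (ha : Function.Injective fun n : ℤ => a ^ n)
    (K L : Finset G) :
    ∃ N : ℕ, ∀ n : ℤ, N ≤ |n| → Disjoint (a ^ n • (L : Set G)) (K : Set G) := by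
  have hfin : {n : ℤ | a ^ n ∈ (K : Set G) * (L : Set G)⁻¹}.Finite :=
    ((K.finite_toSet.mul L.finite_toSet.inv).preimage ha.injOn)
  obtain ⟨b, hb⟩ := (hfin.image abs).bddAbove
  refine ⟨(b + 1).toNat, fun n hn => Set.disjoint_left.mpr ?_⟩
  rintro _ ⟨l, hl, rfl⟩ hk
  have := hb ⟨n, (⟨_, hk, l⁻¹, Set.inv_mem_inv.mpr hl, by simp⟩ :
    a ^ n ∈ (K : Set G) * (L : Set G)⁻¹), rfl⟩
  omega

/-- The Cayley graph of a virtually infinite cyclic group has two ends. -/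
theorem card_end_mulCayley_eq_two [Infinite G] (hS : S.Finite) (hgen : Subgroup.closure S = ⊤)
    {a : G} (ha : (Subgroup.zpowers a).FiniteIndex) : ENat.card (mulCayley S).end = 2 := by
  classical
  have := mulCayleyLocallyFinite hS
  have hΓ := mulCayley_preconnected hgen
  have hinj := zpow_injective_of_finiteIndex_zpowers ha
  obtain ⟨F, hF⟩ : ∃ F : Finset G, ∀ x : G, ∃ n : ℤ, ∃ f ∈ F, x = a ^ n * f := by
    obtain ⟨F, hF⟩ := exists_finite_rightCoset_cover (Subgroup.zpowers a)
    refine ⟨F, fun x => ?_⟩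
    obtain ⟨_, ⟨n, rfl⟩, f, hf, rfl⟩ := hF x
    exact ⟨n, f, hf, rfl⟩
  obtain ⟨K, hK, hE⟩ := exists_cutBy_zpow_mul hS hF
  obtain ⟨n₀, f₀, hf₀, -⟩ := hF 1
  refine card_end_eq_two hΓ hK hE ?_ ?_ fun K => ?_
  · refine Set.infinite_of_injective_forall_mem (f := fun n : ℕ => a ^ (n : ℤ) * f₀) ?_
      fun n => ⟨n, by simp, f₀, hf₀, rfl⟩
    exact fun n k h => Nat.cast_injective (hinj (mul_right_cancel h))
  · have hfin : {n : ℤ | a ^ n ∈ F}.Finite := F.finite_toSet.preimage hinj.injOn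
    obtain ⟨b, hb⟩ := hfin.bddBelow
    -- These exponents lie below `b`; writing such a power as `a ^ k * f` with `k ≥ 0` would put a
    -- power with exponent below `b` into `F`.
    refine Set.infinite_of_injective_forall_mem (f := fun n : ℕ => a ^ (-(n : ℤ) - 1 - |b|)) ?_
      fun n => ?_
    · intro n k h
      have := hinj h
      simpa using this
    · rintro ⟨k, hk, f, hf, hnf⟩
      have : a ^ (-(n : ℤ) - 1 - |b| - k) ∈ F := by
        rw [show -(n : ℤ) - 1 - |b| - k = -k + (-(n : ℤ) - 1 - |b|) by ring, zpow_add, hnf]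
        simpa using hf
      have := hb this
      have := neg_abs_le b
      omega
  -- Having 1 and `a` in `L` makes consecutive connected translates `a ^ n • L` overlap, so those
  -- with `n ≥ N` lie in one component off `K`, and likewise those with `n ≤ -N`. Having `F` in `L`
  -- leaves only finitely many other vertices.
  · obtain ⟨L, hFL, hL⟩ := extend_finset_to_connected hΓ (t := insert a (insert 1 F)) (by simp)
    have h1L : (1 : G) ∈ (L : Set G) := hFL (by simp)
    have haL : a ∈ (L : Set G) := hFL (by simp)
    obtain ⟨N, hN⟩ := exists_disjoint_zpow_smul hinj K L
    have hmem {n : ℤ} (hn : N ≤ |n|) {x : G} (hx : x ∈ a ^ n • (L : Set G)) : x ∉ (K : Set G) :=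
      Set.disjoint_left.mp (hN n hn) hx
    have h1 (n : ℤ) : a ^ n ∈ a ^ n • (L : Set G) := ⟨1, h1L, by simp⟩
    have hconn {n : ℤ} (hn : N ≤ |n|) {x y : G} (hx : x ∈ a ^ n • (L : Set G))
        (hy : y ∈ a ^ n • (L : Set G)) : (mulCayley S).componentComplMk (hmem hn hx) =
          (mulCayley S).componentComplMk (hmem hn hy) := by
      have hr := preconnected_induce_smul hL.preconnected (a ^ n) ⟨x, hx⟩ ⟨y, hy⟩
      exact ConnectedComponent.sound (hr.map (induceHomOfLE _ fun z hz => hmem hn hz).toHom)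
    have hp (n : ℕ) (hn : N ≤ n) : (mulCayley S).componentComplMk
        (hmem (n := n) (by simpa using hn) (h1 n)) =
        (mulCayley S).componentComplMk (hmem (n := N) (by simp) (h1 N)) := by
      induction n, hn using Nat.le_induction with
      | base => rfl
      | succ n hn ih =>
        rw [← ih]
        exact (hconn (n := n) (by simpa using hn) (h1 n)
          (⟨a, haL, by simp [zpow_add_one]⟩)).symm
    have hm (n : ℕ) (hn : N ≤ n) : (mulCayley S).componentComplMk
        (hmem (n := -n) (by simpa using hn) (h1 (-n))) =
        (mulCayley S).componentComplMk (hmem (n := -N) (by simp) (h1 (-N))) := by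
      induction n, hn using Nat.le_induction with
      | base => rfl
      | succ n hn ih =>
        rw [← ih]
        refine hconn (n := -(n + 1 : ℕ)) (by rw [abs_neg, Nat.abs_cast]; omega) (h1 _)
          (⟨a, haL, ?_⟩)
        refine (zpow_add_one a _).symm.trans (congrArg _ ?_)
        push_cast
        ring
    refine ⟨(mulCayley S).componentComplMk (hmem (n := N) (by simp) (h1 N)),
      (mulCayley S).componentComplMk (hmem (n := -N) (by simp) (h1 (-N))), ?_⟩
    refine (((Set.finite_Ioo (-N : ℤ) N).prod F.finite_toSet).image
      fun p : ℤ × G => a ^ p.1 * p.2).subset fun x hx => ?_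
    obtain ⟨n, f, hf, rfl⟩ := hF x
    have hxL : a ^ n * f ∈ a ^ n • (L : Set G) := ⟨f, hFL (by simp [hf]), rfl⟩
    by_contra hcon
    have hnN : N ≤ n ∨ n ≤ -N := by
      by_contra h
      push Not at h
      exact hcon ⟨(n, f), ⟨⟨by omega, by omega⟩, hf⟩, rfl⟩
    rcases hnN with h | h
    · obtain ⟨k, rfl⟩ := Int.eq_ofNat_of_zero_le (show 0 ≤ n by omega)
      exact hx (Or.inl ⟨_, (hconn (n := k) (by simpa using h) hxL (h1 k)).trans
        (hp k (by simpa using h))⟩)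
    · obtain ⟨k, hk⟩ := Int.eq_ofNat_of_zero_le (show 0 ≤ -n by omega)
      obtain rfl : n = -k := by omega
      have hk' : N ≤ k := by omega
      exact hx (Or.inr ⟨_, (hconn (n := -k) (by simpa using hk') hxL (h1 (-k))).trans
        (hm k hk')⟩)

end SimpleGraph

/-! ### Closure properties of varieties and their quotients -/

namespace IsVarietyOfFiniteGroups

variable {C : GroupClass.{u}} (hC : IsVarietyOfFiniteGroups C) {Q R : Type u} [Group Q] [Group R]
include hC

theorem of_injective (f : Q →* R) (hf : Function.Injective f) (hR : C R) : C Q :=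
  hC.of_mulEquiv _ _ (MonoidHom.ofInjective hf).symm (hC.subgroup R f.range hR)

theorem of_ker (f : Q →* R) (hK : C f.ker) (hR : C R) : C Q :=
  hC.extension Q f.ker hK
    (hC.of_injective (QuotientGroup.kerLift f) (QuotientGroup.kerLift_injective f) hR)

theorem prod (hQ : C Q) (hR : C R) : C (Q × R) := by
  refine hC.of_ker (MonoidHom.fst Q R)
    (hC.of_injective ((MonoidHom.snd Q R).comp (MonoidHom.fst Q R).ker.subtype) ?_ hR) hQ
  rintro ⟨⟨x, y⟩, hx⟩ ⟨⟨x', y'⟩, hx'⟩ h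
  rw [MonoidHom.mem_ker] at hx hx'
  simp_all

end IsVarietyOfFiniteGroups

/-- Induction on the order: split off a subgroup of order `p`, isomorphic to `P`, and use closure
under extensions. -/
theorem IsVarietyOfFiniteGroups.of_exponent_prime {C : GroupClass.{u}}
    (hC : IsVarietyOfFiniteGroups C) {P : Type u} [Group P] (hP : C P) {p : ℕ} (hp : p.Prime)
    (hPp : Nat.card P = p) (A : Type u) [CommGroup A] [Finite A] (hA : ∀ a : A, a ^ p = 1) :
    C A := by
  induction hn : Nat.card A using Nat.strong_induction_on generalizing A with
  | h n ih =>
  rcases subsingleton_or_nontrivial A with hs | hs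
  · exact hC.of_injective (1 : A →* P) (Function.injective_of_subsingleton _) hP
  · obtain ⟨a, ha⟩ := exists_ne (1 : A)
    have := Fact.mk hp
    have hcard : Nat.card (Subgroup.zpowers a) = p := by
      rw [Nat.card_zpowers]
      exact orderOf_eq_prime (hA a) ha
    refine hC.extension A (Subgroup.zpowers a)
      (hC.of_mulEquiv _ _ (mulEquivOfPrimeCardEq hPp hcard) hP) ?_
    refine ih _ ?_ (A ⧸ Subgroup.zpowers a) (fun x => ?_) rfl
    · rw [← hn, (Subgroup.zpowers a).card_eq_card_quotient_mul_card_subgroup, hcard]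
      exact lt_mul_of_one_lt_right Nat.card_pos hp.one_lt
    · induction x using QuotientGroup.induction_on with
      | H x => rw [← QuotientGroup.mk_pow, hA, QuotientGroup.mk_one]

theorem exists_prime_card_of_mem {C : GroupClass.{u}} (hC : IsVarietyOfFiniteGroups C) {Q : Type u}
    [Group Q] [Nontrivial Q] (hQ : C Q) :
    ∃ p : ℕ, p.Prime ∧ ∃ P : Subgroup Q, C P ∧ Nat.card P = p := by
  have := hC.finite Q hQ
  obtain ⟨p, hp, hpQ⟩ := Nat.exists_prime_and_dvd (Finite.one_lt_card (α := Q)).ne'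
  have := Fact.mk hp
  obtain ⟨x, hx⟩ := exists_prime_orderOf_dvd_card' p hpQ
  exact ⟨p, hp, Subgroup.zpowers x, hC.subgroup _ _ hQ, by rw [Nat.card_zpowers, hx]⟩

namespace CoNormalSubgroup

variable {C : GroupClass.{u}} {G : Type u} [Group G]

/-- The kernel of a homomorphism to a group in `C`. -/
def ofHom (hC : IsVarietyOfFiniteGroups C) {Q : Type u} [Group Q] (hQ : C Q) (f : G →* Q) :
    CoNormalSubgroup C G where
  toSubgroup := f.ker
  normal := inferInstance
  quotient_mem :=
    hC.of_injective (QuotientGroup.kerLift f) (QuotientGroup.kerLift_injective f) hQ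

theorem exists_eq_inf (hC : IsVarietyOfFiniteGroups C) (M N : CoNormalSubgroup C G) :
    ∃ K : CoNormalSubgroup C G, K.toSubgroup = M.toSubgroup ⊓ N.toSubgroup := by
  refine ⟨ofHom hC (hC.prod M.quotient_mem N.quotient_mem)
    ((QuotientGroup.mk' M.toSubgroup).prod (QuotientGroup.mk' N.toSubgroup)), ?_⟩
  simp [ofHom, MonoidHom.ker_prod]

theorem exists_forall_le (hC : IsVarietyOfFiniteGroups C) [Nonempty (CoNormalSubgroup C G)]
    (I : Finset (CoNormalSubgroup C G)) :
    ∃ K : CoNormalSubgroup C G, ∀ N ∈ I, K.toSubgroup ≤ N.toSubgroup := by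
  classical
  induction I using Finset.induction_on with
  | empty => exact ⟨Classical.arbitrary _, by simp⟩
  | insert N I _ ih =>
    obtain ⟨K, hK⟩ := ih
    obtain ⟨L, hL⟩ := exists_eq_inf hC N K
    refine ⟨L, fun N' hN' => ?_⟩
    rcases Finset.mem_insert.mp hN' with rfl | h
    · exact hL.le.trans inf_le_left
    · exact (hL.le.trans inf_le_right).trans (hK N' h)

end CoNormalSubgroup

/-! ### The pro-`C` completion -/

namespace proCompletion

variable {C : GroupClass.{u}} {G : Type u} [Group G]

/-- The canonical homomorphism from a group to its pro-`C` completion. -/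
def of (C : GroupClass.{u}) (G : Type u) [Group G] : G →* proCompletion C G where
  toFun g := ⟨fun _ => (g : G ⧸ _), fun _ _ _ => rfl⟩
  map_one' := rfl
  map_mul' _ _ := rfl

/-- The projection of the pro-`C` completion to a quotient. -/
def proj (N : CoNormalSubgroup C G) : proCompletion C G →* N.Quot :=
  (Pi.evalMonoidHom (fun N : CoNormalSubgroup C G => N.Quot) N).comp (proCompletion C G).subtype

theorem continuous_proj (N : CoNormalSubgroup C G) : Continuous (proj N) :=
  (continuous_apply N).comp continuous_subtype_val

theorem proj_of (N : CoNormalSubgroup C G) (g : G) : proj N (of C G g) = (g : N.Quot) := rfl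

theorem transition_proj {M N : CoNormalSubgroup C G} (h : M.toSubgroup ≤ N.toSubgroup)
    (x : proCompletion C G) : CoNormalSubgroup.transition M N h (proj M x) = proj N x :=
  x.2 M N h

theorem proj_surjective (N : CoNormalSubgroup C G) : Function.Surjective (proj N) := fun x => by
  obtain ⟨g, rfl⟩ := QuotientGroup.mk_surjective x
  exact ⟨of C G g, rfl⟩

/-- This is density of `G`: a basic neighbourhood of `x` constrains finitely many coordinates, all
determined by a single deeper quotient. -/
theorem exists_apply_of_eq (hC : IsVarietyOfFiniteGroups C) [Nonempty (CoNormalSubgroup C G)]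
    {Q : Type u} [TopologicalSpace Q] [DiscreteTopology Q] {f : proCompletion C G → Q}
    (hf : Continuous f) (x : proCompletion C G) : ∃ g : G, f (of C G g) = f x := by
  obtain ⟨V, hV, hVf⟩ := isOpen_induced_iff.mp ((isOpen_discrete {f x}).preimage hf)
  have hxV : x.1 ∈ V := by
    have : x ∈ Subtype.val ⁻¹' V := by
      rw [hVf]
      exact Set.mem_singleton _
    exact this
  obtain ⟨I, v, hv, hIV⟩ := isOpen_pi_iff.mp hV _ hxV
  obtain ⟨K, hK⟩ := CoNormalSubgroup.exists_forall_le hC I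
  obtain ⟨g, hg⟩ := QuotientGroup.mk_surjective (x.1 K)
  refine ⟨g, ?_⟩
  have : of C G g ∈ Subtype.val ⁻¹' V := hIV fun N hN => by
    have hN' : x.1 N = (of C G g).1 N := by
      rw [← x.2 K N (hK N hN), ← hg]
      rfl
    rw [← hN']
    exact (hv N hN).2
  rw [hVf] at this
  exact this

theorem of_injective (hG : IsResiduallyClass C G) : Function.Injective (of C G) := by
  rw [injective_iff_map_eq_one]
  intro g hg
  by_contra hne
  obtain ⟨N, hN⟩ := hG g hne
  refine hN ((QuotientGroup.eq_one_iff g).mp ?_)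
  rw [← proj_of N g, hg, map_one]

theorem finite [Finite G] : Finite (proCompletion C G) := by
  have hinj : Function.Injective (CoNormalSubgroup.toSubgroup (C := C) (G := G)) := by
    rintro ⟨M, _, _⟩ ⟨N, _, _⟩ h
    cases h
    rfl
  have := Finite.of_injective _ hinj
  have (N : CoNormalSubgroup C G) : Finite N.Quot := inferInstance
  infer_instance

end proCompletion

/-! ### Transferring virtual cyclicity between pro-`C` equivalent groups -/

section ProEquivalent

variable {C : GroupClass.{u}} {G H : Type u} [Group G] [Group H]

theorem infinite_of_proEquivalent [Infinite H] (hH : IsResiduallyClass C H)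
    (h : ProEquivalent C G H) : Infinite G := by
  by_contra hG
  rw [not_infinite_iff_finite] at hG
  obtain ⟨φ⟩ := h
  have := proCompletion.finite (C := C) (G := G)
  have : Finite (proCompletion C H) := Finite.of_equiv _ φ.toEquiv
  have := Finite.of_injective _ (proCompletion.of_injective hH)
  exact not_finite H

/-- Every quotient in `C` of a group is compatibly a quotient of each pro-`C` equivalent group. -/
theorem exists_compatible_surjections (hC : IsVarietyOfFiniteGroups C) (h : ProEquivalent C G H) :
    ∃ f : (K : CoNormalSubgroup C G) → H →* K.Quot, (∀ K, Function.Surjective (f K)) ∧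
      ∀ (K M : CoNormalSubgroup C G) (hKM : K.toSubgroup ≤ M.toSubgroup) (x : H),
        CoNormalSubgroup.transition K M hKM (f K x) = f M x := by
  obtain ⟨φ⟩ := h
  let ψ : proCompletion C H →* proCompletion C G := φ.symm.toMulEquiv.toMonoidHom
  have hψ : Continuous ψ := φ.symm.continuous
  refine ⟨fun K => ((proCompletion.proj K).comp ψ).comp (proCompletion.of C H), fun K y => ?_,
    fun K M hKM x => proCompletion.transition_proj hKM _⟩
  have : Nonempty (CoNormalSubgroup C H) :=
    ⟨CoNormalSubgroup.ofHom hC K.quotient_mem (1 : H →* K.Quot)⟩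
  obtain ⟨x, rfl⟩ := proCompletion.proj_surjective K y
  obtain ⟨g, hg⟩ := proCompletion.exists_apply_of_eq hC
    ((proCompletion.continuous_proj K).comp hψ) (φ x)
  refine ⟨g, hg.trans ?_⟩
  exact congrArg (proCompletion.proj K) (φ.symm_apply_apply x)

/-- A group all of whose quotients in `C` are compatibly quotients of a virtually cyclic group has
a normal subgroup, with quotient in `C`, all of whose images in smaller quotients are cyclic. -/
theorem exists_forall_isCyclic_map [Nonempty (CoNormalSubgroup C G)] {a : H}
    (ha : (Subgroup.zpowers a).FiniteIndex) (f : (K : CoNormalSubgroup C G) → H →* K.Quot)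
    (hf : ∀ K, Function.Surjective (f K))
    (hfc : ∀ (K M : CoNormalSubgroup C G) (hKM : K.toSubgroup ≤ M.toSubgroup) (x : H),
      CoNormalSubgroup.transition K M hKM (f K x) = f M x) :
    ∃ M : CoNormalSubgroup C G, ∀ K : CoNormalSubgroup C G, K.toSubgroup ≤ M.toSubgroup →
      IsCyclic (M.toSubgroup.map (QuotientGroup.mk' K.toSubgroup)) := by
  let B (K : CoNormalSubgroup C G) : Subgroup G :=
    (Subgroup.zpowers (f K a)).comap (QuotientGroup.mk' K.toSubgroup)
  have hB (K) : (B K).index ∣ (Subgroup.zpowers a).index := by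
    rw [Subgroup.index_comap_of_surjective _ (QuotientGroup.mk'_surjective _),
      ← MonoidHom.map_zpowers]
    exact Subgroup.index_map_dvd _ (hf K)
  have hBpos (K) : 0 < (B K).index :=
    Nat.pos_of_dvd_of_pos (hB K) (Nat.pos_of_ne_zero ha.index_ne_zero)
  have hBle (K) : (B K).index ≤ (Subgroup.zpowers a).index :=
    Nat.le_of_dvd (Nat.pos_of_ne_zero ha.index_ne_zero) (hB K)
  let d (K : CoNormalSubgroup C G) : ℕ := (Subgroup.zpowers a).index - (B K).index
  -- Minimizing the deficit `d` maximizes the bounded index of `B`.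
  refine ⟨Function.argmin d, fun K hK => ?_⟩
  set M := Function.argmin d
  have hmax : (B K).index ≤ (B M).index := by
    have h1 : d M ≤ d K := Function.argmin_le d K
    have := hBle K
    have := hBle M
    simp only [d] at h1
    omega
  have hBKM : B K ≤ B M := by
    intro x hx
    obtain ⟨n, hn⟩ := Subgroup.mem_zpowers_iff.mp (Subgroup.mem_comap.mp hx)
    refine Subgroup.mem_comap.mpr (Subgroup.mem_zpowers_iff.mpr ⟨n, ?_⟩)
    rw [← hfc K M hK a, ← map_zpow, hn]
    rfl
  -- `B K` has index at least that of `B M`, and maximality gives equality; since `B M` contains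
  -- `M`, so does `B K`.
  have hBMK : B M ≤ B K := by
    rw [← Subgroup.relIndex_eq_one]
    have h1 := Subgroup.relIndex_mul_index hBKM
    have h2 : (B K).relIndex (B M) * (B M).index ≤ 1 * (B M).index := by
      rwa [h1, one_mul]
    have h3 := Nat.le_of_mul_le_mul_right h2 (hBpos M)
    have h4 : (B K).relIndex (B M) ≠ 0 := fun h0 => by
      rw [h0, zero_mul] at h1
      exact (hBpos K).ne h1
    omega
  have hle : M.toSubgroup.map (QuotientGroup.mk' K.toSubgroup) ≤ Subgroup.zpowers (f K a) := by
    rw [Subgroup.map_le_iff_le_comap]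
    refine le_trans (fun x hx => ?_) hBMK
    have : QuotientGroup.mk' M.toSubgroup x = 1 := (QuotientGroup.eq_one_iff x).mpr hx
    exact Subgroup.mem_comap.mpr (this ▸ one_mem _)
  exact isCyclic_of_injective (Subgroup.inclusion hle) (Subgroup.inclusion_injective hle)

theorem commute_of_isCyclic_map (hC : IsVarietyOfFiniteGroups C) (hG : IsResiduallyClass C G)
    {M : CoNormalSubgroup C G}
    (hM : ∀ K : CoNormalSubgroup C G, K.toSubgroup ≤ M.toSubgroup →
      IsCyclic (M.toSubgroup.map (QuotientGroup.mk' K.toSubgroup)))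
    {x y : G} (hx : x ∈ M.toSubgroup) (hy : y ∈ M.toSubgroup) : x * y = y * x := by
  by_contra hne
  obtain ⟨K, hK⟩ := hG ((x * y)⁻¹ * (y * x)) (by rwa [Ne, inv_mul_eq_one])
  obtain ⟨L, hL⟩ := CoNormalSubgroup.exists_eq_inf hC K M
  have := hM L (hL.le.trans inf_le_right)
  have hcomm : IsMulCommutative (M.toSubgroup.map (QuotientGroup.mk' L.toSubgroup)) :=
    IsCyclic.isMulCommutative
  have h := hcomm.is_comm.comm ⟨_, Subgroup.mem_map_of_mem _ hx⟩ ⟨_, Subgroup.mem_map_of_mem _ hy⟩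
  have h : ((x * y : G) : G ⧸ L.toSubgroup) = ((y * x : G) : G ⧸ L.toSubgroup) :=
    congrArg Subtype.val h
  rw [QuotientGroup.eq] at h
  exact hK (hL.le.trans inf_le_left h)

/-- The `n`-th powers of elements of a subgroup with commuting elements. -/
def powSubgroup (M : Subgroup G) (hM : ∀ x ∈ M, ∀ y ∈ M, x * y = y * x) (n : ℕ) : Subgroup G where
  carrier := {x | ∃ y ∈ M, y ^ n = x}
  one_mem' := ⟨1, one_mem _, one_pow _⟩
  mul_mem' := by
    rintro _ _ ⟨x, hx, rfl⟩ ⟨y, hy, rfl⟩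
    exact ⟨x * y, mul_mem hx hy, (show Commute x y from hM x hx y hy).mul_pow n⟩
  inv_mem' := by
    rintro _ ⟨x, hx, rfl⟩
    exact ⟨x⁻¹, inv_mem hx, inv_pow _ _⟩

theorem powSubgroup_le {M : Subgroup G} (hM : ∀ x ∈ M, ∀ y ∈ M, x * y = y * x) (n : ℕ) :
    powSubgroup M hM n ≤ M := by
  rintro _ ⟨x, hx, rfl⟩
  exact pow_mem hx n

theorem powSubgroup_normal {M : Subgroup G} [M.Normal] (hM : ∀ x ∈ M, ∀ y ∈ M, x * y = y * x)
    (n : ℕ) : (powSubgroup M hM n).Normal where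
  conj_mem := by
    rintro _ ⟨x, hx, rfl⟩ g
    exact ⟨g * x * g⁻¹, Subgroup.Normal.conj_mem ‹_› x hx g, conj_pow⟩

/-- The kernel of `G/M^p → G/M` is abelian of exponent `p`, and finitely generated because it has
finite index; so it is finite and in `C`. -/
theorem quotient_powSubgroup_mem [Group.FG G] (hC : IsVarietyOfFiniteGroups C) {P : Type u}
    [Group P] (hP : C P) {p : ℕ} (hp : p.Prime) (hPp : Nat.card P = p) (M : CoNormalSubgroup C G)
    (hM : ∀ x ∈ M.toSubgroup, ∀ y ∈ M.toSubgroup, x * y = y * x)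
    [(powSubgroup M.toSubgroup hM p).Normal] : C (G ⧸ powSubgroup M.toSubgroup hM p) := by
  let f : G ⧸ powSubgroup M.toSubgroup hM p →* G ⧸ M.toSubgroup :=
    QuotientGroup.map _ _ (MonoidHom.id G) (powSubgroup_le hM p)
  have hker {x : G} (hx : (x : G ⧸ powSubgroup M.toSubgroup hM p) ∈ f.ker) : x ∈ M.toSubgroup :=
    (QuotientGroup.eq_one_iff x).mp hx
  have := hC.finite _ M.quotient_mem
  have : Group.FG f.ker := inferInstance
  let inst : CommGroup f.ker :=
    { (inferInstance : Group f.ker) with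
      mul_comm := by
        rintro ⟨x, hx⟩ ⟨y, hy⟩
        induction x using QuotientGroup.induction_on with
        | H x =>
        induction y using QuotientGroup.induction_on with
        | H y =>
        exact Subtype.ext (congrArg QuotientGroup.mk (hM x (hker hx) y (hker hy))) }
  have hpow (x : f.ker) : x ^ p = 1 := by
    obtain ⟨x, hx⟩ := x
    induction x using QuotientGroup.induction_on with
    | H x => exact Subtype.ext ((QuotientGroup.eq_one_iff (x ^ p)).mpr ⟨x, hker hx, rfl⟩)
  have : Finite f.ker := CommGroup.finite_of_fg_isMulTorsion _
    fun x => isOfFinOrder_iff_pow_eq_one.mpr ⟨p, hp.pos, hpow x⟩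
  exact hC.of_ker f (hC.of_exponent_prime hP hp hPp f.ker hpow) M.quotient_mem

/-- A finitely generated abelian group that is divisible by a prime is finite. -/
theorem finite_of_forall_eq_zsmul {B : Type u} [AddCommGroup B] [AddGroup.FG B] {p : ℕ}
    (hp : p.Prime) (h : ∀ b : B, ∃ c : B, b = (p : ℤ) • c) : Finite B := by
  have hfg : Module.Finite ℤ B := Module.Finite.iff_addGroup_fg.mpr inferInstance
  -- Nakayama: `pB = B` yields `r ≡ 1` mod `p` killing `B`. Such an `r` is nonzero, so `B` is
  -- torsion.
  obtain ⟨r, hr, hrB⟩ := Submodule.exists_sub_one_mem_and_smul_eq_zero_of_fg_of_le_smul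
    (Ideal.span {(p : ℤ)}) (⊤ : Submodule ℤ B) hfg.fg_top fun b _ => by
      obtain ⟨c, rfl⟩ := h b
      exact Submodule.smul_mem_smul (Ideal.mem_span_singleton_self _) Submodule.mem_top
  have hr0 : r ≠ 0 := by
    rintro rfl
    rw [Ideal.mem_span_singleton, zero_sub, dvd_neg] at hr
    exact hp.one_lt.ne' (by exact_mod_cast Int.eq_one_of_dvd_one (by positivity) hr)
  exact AddCommGroup.finite_of_fg_isAddTorsion B fun b =>
    isOfFinAddOrder_iff_zsmul_eq_zero.mpr ⟨r, hr0, hrB b Submodule.mem_top⟩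

/-- A finitely generated abelian group generated by an element and the `p`-th powers is virtually
cyclic. -/
theorem finiteIndex_zpowers_of_forall_eq_zpow_mul_pow {A : Type u} [CommGroup A] [Group.FG A]
    {p : ℕ} (hp : p.Prime) (m : A) (h : ∀ x : A, ∃ (n : ℤ) (y : A), x = m ^ n * y ^ p) :
    (Subgroup.zpowers m).FiniteIndex := by
  have : Finite (Additive (A ⧸ Subgroup.zpowers m)) := by
    refine finite_of_forall_eq_zsmul hp fun b => ?_
    obtain ⟨x, hx⟩ := QuotientGroup.mk_surjective b.toMul
    obtain ⟨n, y, hy⟩ := h x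
    refine ⟨Additive.ofMul (y : A ⧸ Subgroup.zpowers m), ?_⟩
    apply Additive.toMul.injective
    rw [← hx, natCast_zsmul, toMul_nsmul, toMul_ofMul, ← QuotientGroup.mk_pow,
      QuotientGroup.eq_iff_div_mem, hy, mul_div_cancel_right]
    exact ⟨n, rfl⟩
  have : Finite (A ⧸ Subgroup.zpowers m) := this
  exact Subgroup.finiteIndex_of_finite_quotient

theorem exists_finiteIndex_zpowers_of_forall_isCyclic_map [Group.FG G] [Infinite G]
    (hC : IsVarietyOfFiniteGroups C) (hG : IsResiduallyClass C G) {M : CoNormalSubgroup C G}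
    (hM : ∀ K : CoNormalSubgroup C G, K.toSubgroup ≤ M.toSubgroup →
      IsCyclic (M.toSubgroup.map (QuotientGroup.mk' K.toSubgroup))) :
    ∃ a : G, (Subgroup.zpowers a).FiniteIndex := by
  have hcomm (x) (hx : x ∈ M.toSubgroup) (y) (hy : y ∈ M.toSubgroup) : x * y = y * x :=
    commute_of_isCyclic_map hC hG hM hx hy
  have := hC.finite _ M.quotient_mem
  have : M.toSubgroup.FiniteIndex := Subgroup.finiteIndex_of_finite_quotient
  obtain ⟨g, hg⟩ := exists_ne (1 : G)
  obtain ⟨N, hN⟩ := hG g hg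
  have : Nontrivial (G ⧸ N.toSubgroup) :=
    ⟨(g : G ⧸ N.toSubgroup), 1, fun h => hN ((QuotientGroup.eq_one_iff g).mp h)⟩
  obtain ⟨p, hp, P, hP, hPp⟩ := exists_prime_card_of_mem hC N.quotient_mem
  have hnormal := powSubgroup_normal hcomm p
  -- Cyclicity is applied to the quotient by `M^p` itself: `m` generates `M` modulo `p`-th powers.
  obtain ⟨⟨_, m, hm, rfl⟩, hgen⟩ := (hM ⟨powSubgroup M.toSubgroup hcomm p, hnormal,
    quotient_powSubgroup_mem hC hP hp hPp M hcomm⟩ (powSubgroup_le hcomm p)).exists_generator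
  let inst : CommGroup M.toSubgroup :=
    { (inferInstance : Group M.toSubgroup) with
      mul_comm := fun x y => Subtype.ext (hcomm x x.2 y y.2) }
  refine exists_finiteIndex_zpowers_of_subgroup M.toSubgroup ⟨⟨m, hm⟩,
    finiteIndex_zpowers_of_forall_eq_zpow_mul_pow hp _ fun x => ?_⟩
  obtain ⟨n, hn⟩ := Subgroup.mem_zpowers_iff.mp (hgen ⟨_, Subgroup.mem_map_of_mem _ x.2⟩)
  have hn : ((m ^ n : G) : G ⧸ powSubgroup M.toSubgroup hcomm p) = (x : G) :=
    congrArg Subtype.val hn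
  rw [QuotientGroup.eq] at hn
  obtain ⟨y, hy, hyx⟩ := hn
  exact ⟨n, ⟨y, hy⟩, Subtype.ext (eq_mul_of_inv_mul_eq hyx.symm)⟩

end ProEquivalent

theorem proposition3p5 (C : GroupClass.{u}) (hC : IsVarietyOfFiniteGroups C)
    (H G : Type u) [Group H] [Group G]
    (hH : IsResiduallyClass C H) (hG : IsResiduallyClass C G)
    -- finite generating sets; in particular both groups are finitely generated
    (S : Set H) (hS : S.Finite) (hS_gen : Subgroup.closure S = ⊤)
    (T : Set G) (hT : T.Finite) (hT_gen : Subgroup.closure T = ⊤)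
    (hGH : ProEquivalent C G H)
    (hH_ends : numEnds S = 2) :
    numEnds T = 2 := by
  have : Infinite H := SimpleGraph.infinite_of_card_end_eq_two hH_ends
  have : Infinite G := infinite_of_proEquivalent hH hGH
  have : Group.FG G := Group.fg_iff.mpr ⟨T, hT_gen, hT⟩
  -- The axioms of a variety allow the empty class; a nontrivial element of `G` supplies a quotient
  -- in `C`.
  obtain ⟨g, hg⟩ := exists_ne (1 : G)
  obtain ⟨N, -⟩ := hG g hg
  have : Nonempty (CoNormalSubgroup C G) := ⟨N⟩
  obtain ⟨a, ha⟩ := exists_finiteIndex_zpowers_of_numEnds_eq_two hS hS_gen hH_ends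
  obtain ⟨f, hf, hfc⟩ := exists_compatible_surjections hC hGH
  obtain ⟨M, hM⟩ := exists_forall_isCyclic_map ha f hf hfc
  obtain ⟨b, hb⟩ := exists_finiteIndex_zpowers_of_forall_isCyclic_map hC hG hM
  exact SimpleGraph.card_end_mulCayley_eq_two hT hT_gen hb
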